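/- Let $(t_i)_{i\ge 1}$ be a (strictly) stationary sequence of random variables whose marginal law has a density $f$ that is decreasing on $\mathbb{R}^+$ (and zero on the negative half-line), with distribution function $F$, and let $t_0>0$. Assume that there is an open interval $I_{t_0}\ni t_0$ with $f\in C^1(I_{t_0})$ and $\sup_{t\in I_{t_0}}f'(t)<0$, that $\mathbb{E}\,t_i^5<\infty$, and that one of the following conditions holds: [a] $(t_i)_{i\ge1}$ is an i.i.d. sequence; [b] 1) $(t_i)_{i\ge 1}$ is $\phi$-mixing with $\sum_{i\ge1}\phi^{1/2}(i)<\infty$, i.e. $\phi(n)\to0$ and, for all $n,k\ge1$ and every event $A\in\sigma(t_j:j\ge k+n)$, $|P(A\mid\sigma(t_j:j\le k))-P(A)|\le\phi(n)$ almost surely; 2) $F'(t_0)=f(t_0)$ exists and, for some $\delta>0$ and all $k\ge1$, $(t_1,t_{1+k})$ has a joint density $f_k$ on $[t_0-\delta,t_0+\delta]^2$; 3) $\sum_{k\ge1}M_k<\infty$, where $M_k=\sup_{t_0-\delta\le s_1,s_2\le t_0+\delta}|f_k(s_1,s_2)-f(s_1)f(s_2)|$. Let $a>0$ and $d_n=h=h_n=an^{-1/3}$.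 Let $F_n^0(t)=\frac1n\sum_{i=1}^n(1_{\{t_i\le t\}}-F(t))$, $\sigma_{n,d_n}^2=\mathrm{Var}\left[n\{F_n^0(t_0+d_n)-F_n^0(t_0)\}\right]$, and $$w_{n,d_n}(s)=\sigma_{n,d_n}^{-1}\,n\,\{F_n^0(t_0+sd_n)-F_n^0(t_0)\}$$ (read as $0$ if $\sigma_{n,d_n}=0$). Let $\epsilon>0$ be such that $\tau:=\sup_{|t-t_0|\le\epsilon}f'(t)<0$, and let $0<M<\infty$ and $0<c<\infty$. Then there exists a positive constant $C'$, not depending on $n$, such that for all $n\ge1$ $$P\left(\sup_{s\in(0,1)}w_{n,d_n}(s)>\frac M2-\tau(\epsilon h^{-1}-c)\right)\le C'h^5 .$$ -/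

import Mathlib

open MeasureTheory ProbabilityTheory Set Filter Topology

noncomputable section

namespace LocalEmpirical

variable {Ω : Type*} [MeasurableSpace Ω]

/-! A sequence of observations `t₁, t₂, …` is encoded as `t : ℕ → Ω → ℝ`, where `t i` is the
observation with number `i + 1`; so the first `n` observations are `t i` with `i < n`. -/

/-- Strict stationarity: every shift of the sequence has the same joint law on `ℕ → ℝ`. -/
def IsStationary (t : ℕ → Ω → ℝ) (P : Measure Ω) : Prop :=
  ∀ m : ℕ, P.map (fun ω (i : ℕ) => t (i + m) ω) = P.map (fun ω (i : ℕ) => t i ω)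

/-- The sigma-algebra generated by the variables with index at most `k`. -/
@[reducible] def past (t : ℕ → Ω → ℝ) (k : ℕ) : MeasurableSpace Ω :=
  ⨆ j : ℕ, ⨆ _ : j ≤ k, MeasurableSpace.comap (t j) inferInstance

/-- The sigma-algebra generated by the variables with index at least `k`. -/
@[reducible] def future (t : ℕ → Ω → ℝ) (k : ℕ) : MeasurableSpace Ω :=
  ⨆ j : ℕ, ⨆ _ : k ≤ j, MeasurableSpace.comap (t j) inferInstance

/-- The sequence is `φ`-mixing with mixing bound `φ`: `φ n → 0`, and for every event `A` of the
future after a gap `n ≥ 1`, `|P(A | past) - P(A)| ≤ φ n` almost surely. -/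
def IsPhiMixing (t : ℕ → Ω → ℝ) (P : Measure Ω) (φ : ℕ → ℝ) : Prop :=
  Tendsto φ atTop (𝓝 0) ∧
    ∀ n : ℕ, 1 ≤ n → ∀ k : ℕ, ∀ A : Set Ω, MeasurableSet[future t (k + n)] A →
      ∀ᵐ ω ∂P, |(P[A.indicator (fun _ => (1 : ℝ)) | past t k]) ω - P.real A| ≤ φ n

/-- `g` is (a version of) the density of the law of `(X, Y)` on the set `S`. -/
def IsJointDensityOn (X Y : Ω → ℝ) (P : Measure Ω) (g : ℝ × ℝ → ℝ) (S : Set (ℝ × ℝ)) : Prop :=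
  Measurable g ∧ (∀ z ∈ S, 0 ≤ g z) ∧
    (P.map (fun ω => (X ω, Y ω))).restrict S =
      ((volume : Measure (ℝ × ℝ)).withDensity (fun z => ENNReal.ofReal (g z))).restrict S

/-- `f` is a decreasing probability density on the positive half-line and is the density of the
law of each `t i`. -/
def HasDecreasingMarginalDensity (t : ℕ → Ω → ℝ) (P : Measure Ω) (f : ℝ → ℝ) : Prop :=
  (∀ x, 0 ≤ f x) ∧ (∀ x < 0, f x = 0) ∧ AntitoneOn f (Ioi 0) ∧
    ∀ i, P.map (t i) = (volume : Measure ℝ).withDensity (fun x => ENNReal.ofReal (f x))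

/-- The marginal distribution function `F`. -/
def margCdf (t : ℕ → Ω → ℝ) (P : Measure Ω) (x : ℝ) : ℝ := P.real {ω | t 0 ω ≤ x}

/-- The weak dependence condition at `t₀`: `φ`-mixing with summable `φ^{1/2}`, existence of
`F'(t₀) = f(t₀)` and of the joint densities `f_k` of the first and the `(1+k)`-th observation near
`(t₀, t₀)`, and `∑_{k ≥ 1} M_k < ∞` with `M_k = sup |f_k(s₁,s₂) - f(s₁) f(s₂)|`, the suprema and
the sum being taken in `[0, ∞]`. -/
def IsWeaklyDependent (t : ℕ → Ω → ℝ) (P : Measure Ω) (f : ℝ → ℝ) (t₀ : ℝ) : Prop :=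
  (∃ φ : ℕ → ℝ, IsPhiMixing t P φ ∧ Summable (fun i : ℕ => (φ (i + 1)) ^ (1 / 2 : ℝ))) ∧
  HasDerivAt (margCdf t P) (f t₀) t₀ ∧
  ∃ δ : ℝ, 0 < δ ∧ ∃ g : ℕ → ℝ × ℝ → ℝ,
    (∀ k : ℕ, 1 ≤ k → IsJointDensityOn (t 0) (t k) P (g k)
      (Icc (t₀ - δ) (t₀ + δ) ×ˢ Icc (t₀ - δ) (t₀ + δ))) ∧
    ∑' k : ℕ, (⨆ s₁ ∈ Icc (t₀ - δ) (t₀ + δ), ⨆ s₂ ∈ Icc (t₀ - δ) (t₀ + δ),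
      ENNReal.ofReal |g (k + 1) (s₁, s₂) - f s₁ * f s₂|) < ⊤

/-- The centered empirical process `F_n⁰(x) = n⁻¹ ∑_{i=1}^n (1_{t_i ≤ x} - F(x))`. -/
def centeredEmp (t : ℕ → Ω → ℝ) (P : Measure Ω) (n : ℕ) (x : ℝ) (ω : Ω) : ℝ :=
  (n : ℝ)⁻¹ * ∑ i ∈ Finset.range n, ((Iic x).indicator (fun _ => (1 : ℝ)) (t i ω) - margCdf t P x)

/-- `σ_{n,d} = (Var[n {F_n⁰(t₀ + d) - F_n⁰(t₀)}])^{1/2}`. -/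
def localSd (t : ℕ → Ω → ℝ) (P : Measure Ω) (t₀ : ℝ) (n : ℕ) (d : ℝ) : ℝ :=
  √(variance (fun ω => (n : ℝ) * (centeredEmp t P n (t₀ + d) ω - centeredEmp t P n t₀ ω)) P)

/-- The empirical process rescaled locally around `t₀` on the scale `d`,
`w_{n,d}(s; t₀) = σ_{n,d}⁻¹ n {F_n⁰(t₀ + s d) - F_n⁰(t₀)}`. -/
def localEmp (t : ℕ → Ω → ℝ) (P : Measure Ω) (t₀ : ℝ) (n : ℕ) (d s : ℝ) (ω : Ω) : ℝ :=
  (localSd t P t₀ n d)⁻¹ * ((n : ℝ) * (centeredEmp t P n (t₀ + s * d) ω - centeredEmp t P n t₀ ω))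

/-- The bandwidth `h = a n^{-1/3}`. -/
def bandwidth (a : ℝ) (n : ℕ) : ℝ := a * (n : ℝ) ^ (-(1 / 3) : ℝ)

end LocalEmpirical

end

/-!
For `n ≥ 1` the rescaled process is `n {F_n⁰(t₀ + s h) - F_n⁰(t₀)} / σ`, whose numerator is the
number `N(s)` of observations in the window `(t₀, t₀ + s h]` minus its mean (`centeredCount`). The
claim is trivial as long as `h` stays away from `0`, so let `h = a n ^ (-1/3)` be small; then
`n = a ^ 3 / h ^ 3`, and the threshold `M / 2 - τ (ε / h - c)` is at least `κ / h` with
`κ = -τ ε / 2 > 0`.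

The density is positive at `t₀`, because `f' (t₀) < 0` excludes a minimum there. Hence a single
observation hits the window of length `h` with probability at least `f (t₀) h / 2`, while the
covariances of the hits are bounded below by `-M_k h ^ 2`, of smaller order after summation over
`k`. So `σ ^ 2` is at least `n h f (t₀) / 4`, of order `h ^ (-2)`
(`exists_le_variance_centeredCount`), and the event requires `N(s) - E N(s)` to exceed
`b κ / h ^ 2` for some `s`. This is of the same order as the mean `E N(1)` itself. Since `N` is
monotone, cutting the window into a fixed number `K` of cells, each with mean count at most half of
that bound, reduces the supremum to `K` fixed windows (`exists_centeredCount_grid_ge`).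

For one window, no moment inequality is needed: the deviation, of order `n ^ (2/3)`, is so large
compared with `n ^ (1/2)` that the crude bound for sums of `n` bounded terms suffices. The
martingale `k ↦ E[N - E N | t_0, …, t_k]` has increments at most `2 ∑ φ`, and the Azuma–Hoeffding
inequality gives the probability bound `exp (-y / h)` (`measureReal_centeredCount_ge_le`), which is
smaller than a multiple of `h ^ 5`. Independence enters as mixing with `φ = 0` and vanishing
covariances, so the two dependence conditions share one argument.
-/

open MeasureTheory ProbabilityTheory Set Filter Topology

noncomputable section

namespace LocalEmpirical

/-! ### An exponential inequality for bounded martingale differences -/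

theorem integrable_exp_mul_of_bound {Ω : Type*} {mΩ : MeasurableSpace Ω} {P : Measure Ω}
    [IsFiniteMeasure P] {Y : Ω → ℝ} (hY : AEStronglyMeasurable Y P) {B : ℝ}
    (hYB : ∀ᵐ ω ∂P, |Y ω| ≤ B) (l : ℝ) : Integrable (fun ω => Real.exp (l * Y ω)) P := by
  refine Integrable.of_bound (C := Real.exp (|l| * B))
    (Real.continuous_exp.comp_aestronglyMeasurable (hY.const_mul l)) ?_
  filter_upwards [hYB] with ω hω
  rw [Real.norm_eq_abs, Real.abs_exp, Real.exp_le_exp]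
  calc l * Y ω ≤ |l * Y ω| := le_abs_self _
    _ = |l| * |Y ω| := abs_mul _ _
    _ ≤ |l| * B := by gcongr

/-- Adding a bounded increment with vanishing conditional mean multiplies the exponential moment
by at most `exp ((l * c) ^ 2 / 2)`: bound `exp (l * z)` on `[-c, c]` by its chord, whose linear
part integrates to zero against a function of the past. -/
theorem integral_exp_mul_add_le {Ω : Type*} {m mΩ : MeasurableSpace Ω} (hm : m ≤ mΩ)
    {P : Measure Ω} [IsProbabilityMeasure P] {Y Z : Ω → ℝ} (hY : StronglyMeasurable[m] Y) {B : ℝ}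
    (hYB : ∀ᵐ ω ∂P, |Y ω| ≤ B) (hZ : Integrable Z P) {c : ℝ} (hc : 0 < c)
    (hZc : ∀ᵐ ω ∂P, |Z ω| ≤ c) (hZm : P[Z | m] =ᵐ[P] 0) (l : ℝ) :
    ∫ ω, Real.exp (l * (Y ω + Z ω)) ∂P ≤
      Real.exp ((l * c) ^ 2 / 2) * ∫ ω, Real.exp (l * Y ω) ∂P := by
  have hYae : AEStronglyMeasurable Y P := (hY.mono hm).aestronglyMeasurable
  have hE : Integrable (fun ω => Real.exp (l * Y ω)) P := integrable_exp_mul_of_bound hYae hYB l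
  have hEm : StronglyMeasurable[m] (fun ω => Real.exp (l * Y ω)) :=
    Real.continuous_exp.comp_stronglyMeasurable (hY.const_mul l)
  have hEb : ∀ᵐ ω ∂P, ‖Real.exp (l * Y ω)‖ ≤ Real.exp (|l| * B) := by
    filter_upwards [hYB] with ω hω
    rw [Real.norm_eq_abs, Real.abs_exp, Real.exp_le_exp]
    calc l * Y ω ≤ |l * Y ω| := le_abs_self _
      _ = |l| * |Y ω| := abs_mul _ _
      _ ≤ |l| * B := by gcongr
  have hEZ : Integrable (fun ω => Real.exp (l * Y ω) * Z ω) P :=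
    hZ.bdd_mul hE.aestronglyMeasurable hEb
  have hEZ0 : ∫ ω, Real.exp (l * Y ω) * Z ω ∂P = 0 := by
    have h1 := condExp_stronglyMeasurable_mul_of_bound hm hEm hZ _ hEb
    rw [← integral_condExp hm]
    calc ∫ ω, (P[fun ω => Real.exp (l * Y ω) * Z ω | m]) ω ∂P = ∫ ω, (0 : ℝ) ∂P := by
          refine integral_congr_ae ?_
          filter_upwards [h1, hZm] with ω h1 h2
          refine h1.trans ?_
          simp [h2]
      _ = 0 := by simp
  calc ∫ ω, Real.exp (l * (Y ω + Z ω)) ∂P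
      ≤ ∫ ω, (Real.cosh (l * c) * Real.exp (l * Y ω) +
          (Real.sinh (l * c) / c) * (Real.exp (l * Y ω) * Z ω)) ∂P := by
        refine integral_mono_ae ?_ ((hE.const_mul _).add (hEZ.const_mul _)) ?_
        · refine integrable_exp_mul_of_bound (hYae.add hZ.aestronglyMeasurable) (B := B + c) ?_ l
          filter_upwards [hYB, hZc] with ω h1 h2
          exact (abs_add_le _ _).trans (add_le_add h1 h2)
        · filter_upwards [hZc] with ω h
          have h1 : |Z ω / c| ≤ 1 := by
            rw [abs_div, abs_of_pos hc]; exact (div_le_one hc).2 h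
          have h2 := Real.exp_mul_le_cosh_add_mul_sinh h1 (l * c)
          have h3 : Z ω / c * (l * c) = l * Z ω := by field_simp
          rw [h3] at h2
          have h4 : Real.exp (l * (Y ω + Z ω)) = Real.exp (l * Y ω) * Real.exp (l * Z ω) := by
            rw [← Real.exp_add]; ring_nf
          show Real.exp (l * (Y ω + Z ω)) ≤ _
          rw [h4]
          refine (mul_le_mul_of_nonneg_left h2 (Real.exp_pos _).le).trans (le_of_eq ?_)
          field_simp
    _ = Real.cosh (l * c) * ∫ ω, Real.exp (l * Y ω) ∂P := by
        rw [integral_add (hE.const_mul _) (hEZ.const_mul _), integral_const_mul,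
          integral_const_mul, hEZ0, mul_zero, add_zero]
    _ ≤ _ := by
        exact mul_le_mul_of_nonneg_right (Real.cosh_le_exp_half_sq _)
          (integral_nonneg fun _ => (Real.exp_pos _).le)

theorem abs_martingale_le {Ω : Type*} {mΩ : MeasurableSpace Ω} {P : Measure Ω}
    {X : ℕ → Ω → ℝ} {c : ℝ} (h0 : ∀ᵐ ω ∂P, |X 0 ω| ≤ c)
    (hinc : ∀ k, ∀ᵐ ω ∂P, |X (k + 1) ω - X k ω| ≤ c) (n : ℕ) :
    ∀ᵐ ω ∂P, |X n ω| ≤ (n + 1) * c := by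
  induction n with
  | zero => simpa using h0
  | succ n ih =>
    filter_upwards [ih, hinc n] with ω h1 h2
    have : X (n + 1) ω = X n ω + (X (n + 1) ω - X n ω) := by ring
    rw [this]
    refine (abs_add_le _ _).trans ((add_le_add h1 h2).trans (le_of_eq ?_))
    push_cast; ring

theorem integral_exp_martingale_le {Ω : Type*} {mΩ : MeasurableSpace Ω} {P : Measure Ω}
    [IsProbabilityMeasure P] {ℱ : Filtration ℕ mΩ} {X : ℕ → Ω → ℝ} (hX : Martingale X ℱ P)
    {c : ℝ} (hc : 0 < c) (h0 : ∀ᵐ ω ∂P, |X 0 ω| ≤ c) (hmean : ∫ ω, X 0 ω ∂P = 0)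
    (hinc : ∀ k, ∀ᵐ ω ∂P, |X (k + 1) ω - X k ω| ≤ c) (l : ℝ) (n : ℕ) :
    ∫ ω, Real.exp (l * X n ω) ∂P ≤ Real.exp ((l * c) ^ 2 / 2) ^ (n + 1) := by
  induction n with
  | zero =>
    have h := integral_exp_mul_add_le (m := ⊥) bot_le (P := P) (Y := fun _ => (0 : ℝ))
      stronglyMeasurable_const (B := 0) (by simp) (hX.integrable 0) hc h0
      (by rw [condExp_bot, hmean]; rfl) l
    simpa using h
  | succ n ih =>
    have hZm : P[fun ω => X (n + 1) ω - X n ω | ℱ n] =ᵐ[P] 0 := by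
      have h1 := condExp_sub (hX.integrable (n + 1)) (hX.integrable n) (ℱ n)
      have h2 := hX.condExp_ae_eq (Nat.le_succ n)
      have h3 := hX.condExp_ae_eq (le_refl n)
      filter_upwards [h1, h2, h3] with ω h1 h2 h3
      refine h1.trans ?_
      rw [Pi.sub_apply, h3]
      exact sub_eq_zero.2 h2
    have h := integral_exp_mul_add_le (ℱ.le n) (hX.stronglyMeasurable n)
      (abs_martingale_le h0 hinc n) ((hX.integrable (n + 1)).sub (hX.integrable n)) hc
      (hinc n) hZm l
    simp only [Pi.sub_apply, add_sub_cancel] at h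
    refine h.trans ?_
    rw [pow_succ' _ (n + 1)]
    gcongr

/-- The **Azuma–Hoeffding inequality** on an arbitrary probability space. -/
theorem measureReal_martingale_ge_le {Ω : Type*} {mΩ : MeasurableSpace Ω} {P : Measure Ω}
    [IsProbabilityMeasure P] {ℱ : Filtration ℕ mΩ} {X : ℕ → Ω → ℝ} (hX : Martingale X ℱ P)
    {c : ℝ} (hc : 0 < c) (h0 : ∀ᵐ ω ∂P, |X 0 ω| ≤ c) (hmean : ∫ ω, X 0 ω ∂P = 0)
    (hinc : ∀ k, ∀ᵐ ω ∂P, |X (k + 1) ω - X k ω| ≤ c) (n : ℕ) {x : ℝ} (hx : 0 ≤ x) :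
    P.real {ω | x ≤ X n ω} ≤ Real.exp (-(x ^ 2 / (2 * (n + 1) * c ^ 2))) := by
  -- the minimizer of `l ↦ (n + 1) * (l * c) ^ 2 / 2 - l * x`
  set l : ℝ := x / ((n + 1) * c ^ 2) with hl
  have hl0 : 0 ≤ l := by positivity
  have h1 := measure_ge_le_exp_mul_mgf (μ := P) (X := X n) x hl0
    (integrable_exp_mul_of_bound (hX.integrable n).aestronglyMeasurable
      (abs_martingale_le h0 hinc n) l)
  refine h1.trans ?_
  have h2 := integral_exp_martingale_le hX hc h0 hmean hinc l n
  have h3 : mgf (X n) P l = ∫ ω, Real.exp (l * X n ω) ∂P := rfl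
  rw [h3]
  refine (mul_le_mul_of_nonneg_left h2 (Real.exp_pos _).le).trans (le_of_eq ?_)
  rw [← Real.exp_nat_mul, ← Real.exp_add]
  congr 1
  rw [hl]
  push_cast
  field_simp
  ring

/-! ### Concentration of counts under summable mixing coefficients -/

variable {Ω : Type*} [MeasurableSpace Ω]

/-- The centered indicator `1_{t i ∈ A} - P (t i ∈ A)`. -/
def centeredInd (t : ℕ → Ω → ℝ) (P : Measure Ω) (A : Set ℝ) (i : ℕ) (ω : Ω) : ℝ :=
  A.indicator (fun _ => (1 : ℝ)) (t i ω) - P.real (t i ⁻¹' A)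

/-- The number of the first `n` observations that fall into `A`, minus its mean. -/
def centeredCount (t : ℕ → Ω → ℝ) (P : Measure Ω) (A : Set ℝ) (n : ℕ) (ω : Ω) : ℝ :=
  ∑ i ∈ Finset.range n, centeredInd t P A i ω

/-- The form in which mixing enters the concentration bound: events about a single observation at
distance `d ≥ 1` from the past are predicted up to `φ d`, with `φ` summable. The value `φ 0 = 1`
serves the present observation. -/
structure HasSummableMixing (t : ℕ → Ω → ℝ) (P : Measure Ω) (φ : ℕ → ℝ) : Prop where
  summable : Summable φ
  nonneg : ∀ d, 0 ≤ φ d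
  zero : φ 0 = 1
  abs_condExp_le : ∀ A : Set ℝ, MeasurableSet A → ∀ k d : ℕ, 1 ≤ d →
    ∀ᵐ ω ∂P, |(P[centeredInd t P A (k + d) | past t k]) ω| ≤ φ d

variable {t : ℕ → Ω → ℝ} {P : Measure Ω} {A : Set ℝ}

theorem abs_centeredInd_le [IsProbabilityMeasure P] (i : ℕ) (ω : Ω) :
    |centeredInd t P A i ω| ≤ 1 := by
  have h1 : (0 : ℝ) ≤ P.real (t i ⁻¹' A) := measureReal_nonneg
  have h2 : P.real (t i ⁻¹' A) ≤ 1 := measureReal_le_one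
  unfold centeredInd
  by_cases h : t i ω ∈ A
  · rw [indicator_of_mem h, abs_le]; constructor <;> linarith
  · rw [indicator_of_notMem h, abs_le]; constructor <;> linarith

theorem measurable_centeredInd (ht : ∀ i, Measurable (t i)) (hA : MeasurableSet A) (i : ℕ) :
    Measurable (centeredInd t P A i) :=
  ((measurable_const.indicator hA).comp (ht i)).sub_const _

theorem integrable_centeredInd [IsProbabilityMeasure P] (ht : ∀ i, Measurable (t i))
    (hA : MeasurableSet A) (i : ℕ) : Integrable (centeredInd t P A i) P :=
  Integrable.of_bound (measurable_centeredInd ht hA i).aestronglyMeasurable 1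
    (ae_of_all _ fun ω => abs_centeredInd_le i ω)

theorem integral_centeredInd [IsProbabilityMeasure P] (ht : ∀ i, Measurable (t i))
    (hA : MeasurableSet A) (i : ℕ) : ∫ ω, centeredInd t P A i ω ∂P = 0 := by
  have h : ∀ ω, A.indicator (fun _ => (1 : ℝ)) (t i ω) =
      (t i ⁻¹' A).indicator (fun _ => (1 : ℝ)) ω := fun _ => rfl
  unfold centeredInd
  simp_rw [h]
  rw [integral_sub ((integrable_const _).indicator ((ht i) hA)) (integrable_const _),
    integral_indicator_const _ ((ht i) hA)]
  simp

theorem stronglyMeasurable_centeredInd_past (hA : MeasurableSet A) {i k : ℕ} (hik : i ≤ k) :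
    StronglyMeasurable[past t k] (centeredInd t P A i) := by
  have h : Measurable[past t k] (t i) :=
    (comap_measurable (t i)).mono (le_iSup₂_of_le i hik le_rfl) le_rfl
  exact (((measurable_const.indicator hA).comp h).sub_const _).stronglyMeasurable

theorem past_le (ht : ∀ i, Measurable (t i)) (k : ℕ) : past t k ≤ ‹MeasurableSpace Ω› :=
  iSup₂_le fun j _ => (ht j).comap_le

/-- The filtration `k ↦ past t k`. -/
def pastFiltration (t : ℕ → Ω → ℝ) (ht : ∀ i, Measurable (t i)) :
    Filtration ℕ ‹MeasurableSpace Ω› where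
  seq k := past t k
  mono' _ _ hkl := biSup_mono fun _ h => h.trans hkl
  le' k := past_le ht k

theorem sum_range_shift_le_tsum {φ : ℕ → ℝ} (hφ : Summable φ) (h0 : ∀ d, 0 ≤ φ d) (k n : ℕ) :
    ∑ j ∈ Finset.range n, (if k ≤ j then φ (j - k) else 0) ≤ ∑' d, φ d := by
  rw [← Finset.sum_filter]
  rw [← Finset.sum_image (f := φ) (g := fun j => j - k)]
  · exact hφ.sum_le_tsum _ fun d _ => h0 d
  · intro i hi j hj hij
    simp only [Finset.coe_filter, mem_ofPred_eq] at hi hj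
    simp only at hij
    omega

theorem HasSummableMixing.abs_condExp_le_of_le [IsProbabilityMeasure P] {φ : ℕ → ℝ}
    (h : HasSummableMixing t P φ) (ht : ∀ i, Measurable (t i)) (hA : MeasurableSet A) {k j : ℕ}
    (hkj : k ≤ j) : ∀ᵐ ω ∂P, |(P[centeredInd t P A j | past t k]) ω| ≤ φ (j - k) := by
  rcases hkj.eq_or_lt with rfl | hlt
  · rw [condExp_of_stronglyMeasurable (past_le ht k) (stronglyMeasurable_centeredInd_past hA le_rfl)
      (integrable_centeredInd ht hA k), Nat.sub_self, h.zero]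
    exact ae_of_all _ fun ω => abs_centeredInd_le k ω
  · have := h.abs_condExp_le A hA k (j - k) (by omega)
    rwa [Nat.add_sub_of_le hkj] at this

theorem condExp_sum_centeredInd [IsProbabilityMeasure P] (ht : ∀ i, Measurable (t i))
    (hA : MeasurableSet A) (n k : ℕ) :
    P[centeredCount t P A n | past t k] =ᵐ[P]
      fun ω => ∑ j ∈ Finset.range n, (P[centeredInd t P A j | past t k]) ω := by
  have h := condExp_finsetSum (s := Finset.range n)
    (fun j _ => integrable_centeredInd (P := P) ht hA j) (past t k)
  have h1 : centeredCount t P A n = ∑ j ∈ Finset.range n, centeredInd t P A j := by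
    ext ω; simp [centeredCount]
  rw [h1]
  filter_upwards [h] with ω hω
  rw [hω, Finset.sum_apply]

theorem integrable_centeredCount [IsProbabilityMeasure P] (ht : ∀ i, Measurable (t i))
    (hA : MeasurableSet A) (n : ℕ) : Integrable (centeredCount t P A n) P :=
  integrable_finsetSum _ fun i _ => integrable_centeredInd ht hA i

theorem integral_centeredCount [IsProbabilityMeasure P] (ht : ∀ i, Measurable (t i))
    (hA : MeasurableSet A) (n : ℕ) : ∫ ω, centeredCount t P A n ω ∂P = 0 := by
  unfold centeredCount
  rw [integral_finsetSum _ fun i _ => integrable_centeredInd ht hA i]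
  exact Finset.sum_eq_zero fun i _ => integral_centeredInd ht hA i

/-- A Hoeffding bound for dependent observations: the Azuma–Hoeffding inequality applied to the
Doob martingale of the count. Revealing one more observation changes the prediction of the
observation at distance `d` by at most `φ d + φ (d + 1)`, and that of the whole count by at most
`2 * ∑' d, φ d`. -/
theorem measureReal_centeredCount_ge_le [IsProbabilityMeasure P] {φ : ℕ → ℝ}
    (h : HasSummableMixing t P φ) (ht : ∀ i, Measurable (t i)) (hA : MeasurableSet A) {n : ℕ}
    (hn : 1 ≤ n) {x : ℝ} (hx : 0 ≤ x) :
    P.real {ω | x ≤ centeredCount t P A n ω} ≤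
      Real.exp (-(x ^ 2 / (2 * n * (2 * ∑' d, φ d) ^ 2))) := by
  obtain ⟨n, rfl⟩ : ∃ m, n = m + 1 := ⟨n - 1, by omega⟩
  have hΦ : 1 ≤ ∑' d, φ d := by
    rw [← h.zero]; exact h.summable.le_tsum 0 fun d _ => h.nonneg d
  have hall : ∀ k, ∀ᵐ ω ∂P, ∀ j, k ≤ j →
      |(P[centeredInd t P A j | past t k]) ω| ≤ φ (j - k) := by
    intro k
    rw [ae_all_iff]
    intro j
    by_cases hkj : k ≤ j
    · filter_upwards [h.abs_condExp_le_of_le ht hA hkj] with ω hω _ using hω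
    · exact ae_of_all _ fun ω h => absurd h hkj
  have hknown : ∀ {j k}, j ≤ k →
      P[centeredInd t P A j | past t k] = centeredInd t P A j := fun hjk =>
    condExp_of_stronglyMeasurable (past_le ht _) (stronglyMeasurable_centeredInd_past hA hjk)
      (integrable_centeredInd ht hA _)
  have hmart : Martingale (fun k => P[centeredCount t P A (n + 1) | past t k])
      (pastFiltration t ht) P := martingale_condExp _ (pastFiltration t ht) P
  have hlast : P[centeredCount t P A (n + 1) | past t n] =ᵐ[P] centeredCount t P A (n + 1) := by
    filter_upwards [condExp_sum_centeredInd ht hA (n + 1) n] with ω hω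
    rw [hω]
    refine Finset.sum_congr rfl fun j hj => ?_
    rw [hknown (Nat.lt_succ_iff.1 (Finset.mem_range.1 hj))]
  have hfirst : ∀ᵐ ω ∂P, |(P[centeredCount t P A (n + 1) | past t 0]) ω| ≤ 2 * ∑' d, φ d := by
    filter_upwards [condExp_sum_centeredInd ht hA (n + 1) 0, hall 0] with ω hω h0
    rw [hω]
    calc _ ≤ ∑ j ∈ Finset.range (n + 1), |(P[centeredInd t P A j | past t 0]) ω| :=
          Finset.abs_sum_le_sum_abs _ _
      _ ≤ ∑ j ∈ Finset.range (n + 1), φ j := Finset.sum_le_sum fun j _ => h0 j (Nat.zero_le _)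
      _ ≤ ∑' d, φ d := h.summable.sum_le_tsum _ fun d _ => h.nonneg d
      _ ≤ _ := by linarith
  have hinc : ∀ k, ∀ᵐ ω ∂P, |(P[centeredCount t P A (n + 1) | past t (k + 1)]) ω -
      (P[centeredCount t P A (n + 1) | past t k]) ω| ≤ 2 * ∑' d, φ d := by
    intro k
    filter_upwards [condExp_sum_centeredInd ht hA (n + 1) k,
      condExp_sum_centeredInd ht hA (n + 1) (k + 1), hall k, hall (k + 1)] with ω e1 e2 h1 h2
    rw [e1, e2, ← Finset.sum_sub_distrib]
    calc _ ≤ ∑ j ∈ Finset.range (n + 1), |(P[centeredInd t P A j | past t (k + 1)]) ω -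
            (P[centeredInd t P A j | past t k]) ω| := Finset.abs_sum_le_sum_abs _ _
      _ ≤ ∑ j ∈ Finset.range (n + 1), ((if k + 1 ≤ j then φ (j - (k + 1)) else 0) +
            (if k ≤ j then φ (j - k) else 0)) := by
          refine Finset.sum_le_sum fun j _ => ?_
          by_cases hj : k + 1 ≤ j
          · rw [if_pos hj, if_pos (by omega)]
            exact (abs_sub _ _).trans (add_le_add (h2 j hj) (h1 j (by omega)))
          · rw [hknown (show j ≤ k + 1 by omega), hknown (show j ≤ k by omega), sub_self, abs_zero,
              if_neg hj, zero_add]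
            split_ifs
            · exact h.nonneg _
            · exact le_rfl
      _ ≤ 2 * ∑' d, φ d := by
          rw [Finset.sum_add_distrib, two_mul]
          exact add_le_add (sum_range_shift_le_tsum h.summable h.nonneg _ _)
            (sum_range_shift_le_tsum h.summable h.nonneg _ _)
  have hfin := measureReal_martingale_ge_le hmart (c := 2 * ∑' d, φ d) (by linarith) hfirst
    (by rw [integral_condExp (past_le ht 0), integral_centeredCount ht hA]) hinc n hx
  have hset : P.real {ω | x ≤ centeredCount t P A (n + 1) ω} =
      P.real {ω | x ≤ (P[centeredCount t P A (n + 1) | past t n]) ω} := by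
    refine measureReal_congr ?_
    filter_upwards [hlast] with ω hω
    apply propext
    change x ≤ _ ↔ x ≤ _
    rw [hω]
  rw [hset]
  push_cast
  exact hfin

theorem hasSummableMixing_of_iIndepFun (ht : ∀ i, Measurable (t i)) [IsProbabilityMeasure P]
    (hind : iIndepFun t P) : HasSummableMixing t P (fun d => if d = 0 then 1 else 0) where
  summable := summable_of_ne_finset_zero (s := {0}) (by simp)
  nonneg d := by split_ifs <;> norm_num
  zero := rfl
  abs_condExp_le A hA k d hd := by
    have hi : Indep (MeasurableSpace.comap (t (k + d)) inferInstance) (past t k) P :=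
      hind.indep_comap_natural_of_lt (fun i => (ht i).stronglyMeasurable) (by omega)
    have hm : StronglyMeasurable[MeasurableSpace.comap (t (k + d)) inferInstance]
        (centeredInd t P A (k + d)) :=
      (((measurable_const.indicator hA).comp (comap_measurable (t (k + d)))).sub_const
        _).stronglyMeasurable
    filter_upwards [condExp_indep_eq (ht (k + d)).comap_le (past_le ht k) hm hi] with ω hω
    rw [hω, integral_centeredInd ht hA, if_neg (by omega), abs_zero]

theorem summable_of_summable_sqrt {φ : ℕ → ℝ} (h0 : ∀ i, 0 ≤ φ i)
    (h : Summable fun i => φ i ^ (1 / 2 : ℝ)) : Summable φ := by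
  have h1 : ∀ᶠ i in atTop, φ i ^ (1 / 2 : ℝ) ≤ 1 :=
    h.tendsto_atTop_zero.eventually_le_const one_pos
  refine Summable.of_norm_bounded_eventually_nat h ?_
  filter_upwards [h1] with i hi
  have h2 : φ i = φ i ^ (1 / 2 : ℝ) * φ i ^ (1 / 2 : ℝ) := by
    rw [← Real.sqrt_eq_rpow, Real.mul_self_sqrt (h0 i)]
  rw [Real.norm_eq_abs, abs_of_nonneg (h0 i)]
  calc φ i = φ i ^ (1 / 2 : ℝ) * φ i ^ (1 / 2 : ℝ) := h2
    _ ≤ φ i ^ (1 / 2 : ℝ) * 1 := by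
      gcongr
      exact Real.rpow_nonneg (h0 i) _
    _ = _ := mul_one _

theorem hasSummableMixing_of_isPhiMixing (ht : ∀ i, Measurable (t i)) [IsProbabilityMeasure P]
    {φ : ℕ → ℝ} (hφ : IsPhiMixing t P φ)
    (hsum : Summable fun i : ℕ => (φ (i + 1)) ^ (1 / 2 : ℝ)) :
    HasSummableMixing t P (fun d => if d = 0 then 1 else φ d) := by
  have h0 : ∀ d, 1 ≤ d → 0 ≤ φ d := by
    intro d hd
    obtain ⟨ω, hω⟩ := (hφ.2 d hd 0 ∅ (@MeasurableSet.empty _ (future t (0 + d)))).exists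
    exact (abs_nonneg _).trans hω
  refine ⟨?_, ?_, rfl, ?_⟩
  · rw [← summable_nat_add_iff 1]
    simpa using summable_of_summable_sqrt (fun i => h0 (i + 1) (by omega)) hsum
  · intro d
    split_ifs with hd
    · norm_num
    · exact h0 d (by omega)
  · intro A hA k d hd
    have hm : MeasurableSet[future t (k + d)] (t (k + d) ⁻¹' A) :=
      (le_iSup₂_of_le (f := fun j (_ : k + d ≤ j) => MeasurableSpace.comap (t j) inferInstance)
        (k + d) le_rfl le_rfl) _ ⟨A, hA, rfl⟩
    have h1 := condExp_sub (μ := P) (m := past t k)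
      (f := (t (k + d) ⁻¹' A).indicator (fun _ => (1 : ℝ)))
      ((integrable_const _).indicator ((ht (k + d)) hA))
      (integrable_const (P.real (t (k + d) ⁻¹' A)))
    filter_upwards [h1, hφ.2 d hd k _ hm] with ω h1 h2
    rw [if_neg (by omega)]
    have h3 : centeredInd t P A (k + d) = (t (k + d) ⁻¹' A).indicator (fun _ => (1 : ℝ)) -
        fun _ => P.real (t (k + d) ⁻¹' A) := rfl
    rw [h3, h1, Pi.sub_apply, condExp_const (past_le ht k)]
    exact h2

/-! ### A lower bound for the variance of a count -/

theorem sum_range_reflect_le_tsum {φ : ℕ → ℝ} (hφ : Summable φ) (h0 : ∀ d, 0 ≤ φ d) (k n : ℕ) :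
    ∑ j ∈ Finset.range n, (if j ≤ k then φ (k - j) else 0) ≤ ∑' d, φ d := by
  rw [← Finset.sum_filter]
  rw [← Finset.sum_image (f := φ) (g := fun j => k - j)]
  · exact hφ.sum_le_tsum _ fun d _ => h0 d
  · intro i hi j hj hij
    simp only [Finset.coe_filter, mem_ofPred_eq] at hi hj
    simp only at hij
    omega

theorem integrable_centeredInd_mul [IsProbabilityMeasure P] (ht : ∀ i, Measurable (t i))
    (hA : MeasurableSet A) (i j : ℕ) :
    Integrable (fun ω => centeredInd t P A i ω * centeredInd t P A j ω) P :=
  (integrable_centeredInd ht hA j).bdd_mul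
    (measurable_centeredInd ht hA i).aestronglyMeasurable
    (ae_of_all _ fun ω => abs_centeredInd_le i ω)

theorem integral_centeredInd_mul [IsProbabilityMeasure P] (ht : ∀ i, Measurable (t i))
    (hA : MeasurableSet A) (i j : ℕ) :
    ∫ ω, centeredInd t P A i ω * centeredInd t P A j ω ∂P =
      P.real (t i ⁻¹' A ∩ t j ⁻¹' A) - P.real (t i ⁻¹' A) * P.real (t j ⁻¹' A) := by
  have h : ∀ ω, centeredInd t P A i ω * centeredInd t P A j ω =
      (t i ⁻¹' A ∩ t j ⁻¹' A).indicator (fun _ => (1 : ℝ)) ω -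
        P.real (t i ⁻¹' A) * (t j ⁻¹' A).indicator (fun _ => (1 : ℝ)) ω -
        P.real (t j ⁻¹' A) * centeredInd t P A i ω := by
    intro ω
    unfold centeredInd
    by_cases h1 : t i ω ∈ A <;> by_cases h2 : t j ω ∈ A <;>
      simp [indicator, h1, h2] <;> ring
  have h1 : Integrable ((t i ⁻¹' A ∩ t j ⁻¹' A).indicator fun _ => (1 : ℝ)) P :=
    (integrable_const _).indicator (((ht i) hA).inter ((ht j) hA))
  have h2 : Integrable ((t j ⁻¹' A).indicator fun _ => (1 : ℝ)) P :=
    (integrable_const _).indicator ((ht j) hA)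
  have e1 : ∫ ω, (t i ⁻¹' A ∩ t j ⁻¹' A).indicator (fun _ => (1 : ℝ)) ω ∂P =
      P.real (t i ⁻¹' A ∩ t j ⁻¹' A) := by
    rw [integral_indicator_const _ (((ht i) hA).inter ((ht j) hA)), smul_eq_mul, mul_one]
  have e2 : ∫ ω, (t j ⁻¹' A).indicator (fun _ => (1 : ℝ)) ω ∂P = P.real (t j ⁻¹' A) := by
    rw [integral_indicator_const _ ((ht j) hA), smul_eq_mul, mul_one]
  have h3 : Integrable (fun ω => P.real (t i ⁻¹' A) *
      (t j ⁻¹' A).indicator (fun _ => (1 : ℝ)) ω) P := h2.const_mul _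
  have h4 : Integrable (fun ω => (t i ⁻¹' A ∩ t j ⁻¹' A).indicator (fun _ => (1 : ℝ)) ω -
      P.real (t i ⁻¹' A) * (t j ⁻¹' A).indicator (fun _ => (1 : ℝ)) ω) P := h1.sub h3
  simp_rw [h]
  rw [integral_sub h4 ((integrable_centeredInd ht hA i).const_mul _), integral_sub h1 h3,
    integral_const_mul, integral_const_mul, integral_centeredInd ht hA, e1, e2, mul_zero, sub_zero]

theorem variance_centeredCount [IsProbabilityMeasure P] (ht : ∀ i, Measurable (t i))
    (hA : MeasurableSet A) (n : ℕ) :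
    variance (centeredCount t P A n) P = ∑ i ∈ Finset.range n, ∑ j ∈ Finset.range n,
      (P.real (t i ⁻¹' A ∩ t j ⁻¹' A) - P.real (t i ⁻¹' A) * P.real (t j ⁻¹' A)) := by
  rw [variance_of_integral_eq_zero (integrable_centeredCount ht hA n).aemeasurable
    (integral_centeredCount ht hA n)]
  have h : ∀ ω, centeredCount t P A n ω ^ 2 = ∑ i ∈ Finset.range n, ∑ j ∈ Finset.range n,
      centeredInd t P A i ω * centeredInd t P A j ω := fun ω => by
    rw [sq, centeredCount, Finset.sum_mul_sum]
  simp_rw [h]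
  rw [integral_finsetSum _ fun i _ => integrable_finsetSum _ fun j _ =>
    integrable_centeredInd_mul ht hA i j]
  refine Finset.sum_congr rfl fun i _ => ?_
  rw [integral_finsetSum _ fun j _ => integrable_centeredInd_mul ht hA i j]
  exact Finset.sum_congr rfl fun j _ => integral_centeredInd_mul ht hA i j

/-- Only one-sided control of the pair probabilities is needed: a lower bound by
`p ^ 2 - r k` at distance `k`, with `r` summable. -/
theorem le_variance_centeredCount [IsProbabilityMeasure P] (ht : ∀ i, Measurable (t i))
    (hA : MeasurableSet A) {p : ℝ} (hp : ∀ i, P.real (t i ⁻¹' A) = p) {r : ℕ → ℝ}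
    (hr : Summable r) (hr0 : ∀ k, 0 ≤ r k)
    (hpair : ∀ i k, 1 ≤ k → p ^ 2 - r k ≤ P.real (t i ⁻¹' A ∩ t (i + k) ⁻¹' A)) (n : ℕ) :
    n * (p - p ^ 2 - 2 * ∑' k, r k) ≤ variance (centeredCount t P A n) P := by
  rw [variance_centeredCount ht hA]
  have hrow : ∀ i ∈ Finset.range n, p - p ^ 2 - 2 * ∑' k, r k ≤ ∑ j ∈ Finset.range n,
      (P.real (t i ⁻¹' A ∩ t j ⁻¹' A) - P.real (t i ⁻¹' A) * P.real (t j ⁻¹' A)) := by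
    intro i hi
    have h1 := sum_range_shift_le_tsum hr hr0 i n
    have h2 := sum_range_reflect_le_tsum hr hr0 i n
    have h3 : ∑ j ∈ Finset.range n, (if i = j then p - p ^ 2 else 0) = p - p ^ 2 := by
      rw [Finset.sum_ite_eq, if_pos hi]
    have h4 : ∑ j ∈ Finset.range n, ((if i = j then p - p ^ 2 else 0) -
        (if i ≤ j then r (j - i) else 0) - (if j ≤ i then r (i - j) else 0)) ≤
        ∑ j ∈ Finset.range n,
      (P.real (t i ⁻¹' A ∩ t j ⁻¹' A) - P.real (t i ⁻¹' A) * P.real (t j ⁻¹' A)) := by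
      refine Finset.sum_le_sum fun j _ => ?_
      rw [hp, hp]
      rcases lt_trichotomy i j with hij | rfl | hij
      · rw [if_neg hij.ne, if_pos hij.le, if_neg hij.not_ge]
        have := hpair i (j - i) (by omega)
        rw [Nat.add_sub_of_le hij.le] at this
        linarith
      · rw [if_pos rfl, if_pos le_rfl, inter_self, hp]
        have := hr0 (i - i)
        linarith
      · rw [if_neg hij.ne', if_neg hij.not_ge, if_pos hij.le, inter_comm]
        have := hpair j (i - j) (by omega)
        rw [Nat.add_sub_of_le hij.le] at this
        linarith
    rw [Finset.sum_sub_distrib, Finset.sum_sub_distrib, h3] at h4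
    linarith
  have := Finset.card_nsmul_le_sum _ _ _ hrow
  rwa [Finset.card_range, nsmul_eq_mul] at this

/-! ### Probabilities of windows to the right of `t₀` -/

variable {f : ℝ → ℝ}

theorem HasDecreasingMarginalDensity.measure_preimage (hf : HasDecreasingMarginalDensity t P f)
    (ht : ∀ i, Measurable (t i)) (hA : MeasurableSet A) (i : ℕ) :
    P (t i ⁻¹' A) = ∫⁻ x in A, ENNReal.ofReal (f x) := by
  rw [← Measure.map_apply (ht i) hA, hf.2.2.2 i, withDensity_apply _ hA]

theorem HasDecreasingMarginalDensity.measureReal_preimage_eq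
    (hf : HasDecreasingMarginalDensity t P f) (ht : ∀ i, Measurable (t i)) (hA : MeasurableSet A)
    (i j : ℕ) : P.real (t i ⁻¹' A) = P.real (t j ⁻¹' A) := by
  rw [measureReal_def, measureReal_def, hf.measure_preimage ht hA, hf.measure_preimage ht hA]

theorem HasDecreasingMarginalDensity.measureReal_Ioc_le [IsProbabilityMeasure P]
    (hf : HasDecreasingMarginalDensity t P f) (ht : ∀ i, Measurable (t i)) {t₀ x y : ℝ}
    (ht₀ : 0 < t₀) (hx : t₀ ≤ x) (hxy : x ≤ y) (i : ℕ) :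
    P.real (t i ⁻¹' Ioc x y) ≤ f t₀ * (y - x) := by
  rw [measureReal_def]
  refine ENNReal.toReal_le_of_le_ofReal (mul_nonneg (hf.1 t₀) (sub_nonneg.2 hxy)) ?_
  rw [hf.measure_preimage ht measurableSet_Ioc]
  calc ∫⁻ z in Ioc x y, ENNReal.ofReal (f z) ≤ ∫⁻ z in Ioc x y, ENNReal.ofReal (f t₀) := by
        refine setLIntegral_mono measurable_const fun z hz => ENNReal.ofReal_le_ofReal ?_
        exact hf.2.2.1 (mem_Ioi.2 ht₀) (mem_Ioi.2 (by linarith [hz.1])) (by linarith [hz.1])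
    _ = _ := by
        rw [setLIntegral_const, Real.volume_Ioc, ENNReal.ofReal_mul (hf.1 t₀)]

theorem HasDecreasingMarginalDensity.le_measureReal_Ioc [IsProbabilityMeasure P]
    (hf : HasDecreasingMarginalDensity t P f) (ht : ∀ i, Measurable (t i)) {x y q : ℝ}
    (hq : 0 ≤ q) (hfq : ∀ z ∈ Ioc x y, q ≤ f z) (i : ℕ) :
    q * (y - x) ≤ P.real (t i ⁻¹' Ioc x y) := by
  rw [measureReal_def]
  refine (ENNReal.ofReal_le_iff_le_toReal (measure_ne_top _ _)).1 ?_
  rw [hf.measure_preimage ht measurableSet_Ioc]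
  calc ENNReal.ofReal (q * (y - x)) = ∫⁻ z in Ioc x y, ENNReal.ofReal q := by
        rw [setLIntegral_const, Real.volume_Ioc, ENNReal.ofReal_mul hq]
    _ ≤ _ := setLIntegral_mono' measurableSet_Ioc fun z hz => ENNReal.ofReal_le_ofReal (hfq z hz)

theorem IsStationary.measure_pair (hs : IsStationary t P) (ht : ∀ i, Measurable (t i))
    (hA : MeasurableSet A) (i k : ℕ) :
    P (t i ⁻¹' A ∩ t (i + k) ⁻¹' A) = P (t 0 ⁻¹' A ∩ t k ⁻¹' A) := by
  have hB : MeasurableSet {x : ℕ → ℝ | x 0 ∈ A ∧ x k ∈ A} :=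
    (measurable_pi_apply 0 hA).inter (measurable_pi_apply k hA)
  have h := congrArg (fun μ => μ {x : ℕ → ℝ | x 0 ∈ A ∧ x k ∈ A}) (hs i)
  beta_reduce at h
  rw [Measure.map_apply (measurable_pi_lambda _ fun j => ht (j + i)) hB,
    Measure.map_apply (measurable_pi_lambda _ fun j => ht j) hB] at h
  have e1 : t i ⁻¹' A ∩ t (i + k) ⁻¹' A =
      (fun ω (j : ℕ) => t (j + i) ω) ⁻¹' {x : ℕ → ℝ | x 0 ∈ A ∧ x k ∈ A} := by
    ext ω; simp [add_comm i k]
  rw [e1, h]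
  rfl

/-- Integrating `f s₁ * f s₂ ≤ g (s₁, s₂) + m` over the square of a window. -/
theorem IsJointDensityOn.sq_sub_le [IsProbabilityMeasure P]
    (hf : HasDecreasingMarginalDensity t P f) (ht : ∀ i, Measurable (t i)) {t₀ : ℝ}
    (ht₀ : 0 < t₀) {δ : ℝ} {g : ℝ × ℝ → ℝ} {k : ℕ}
    (hg : IsJointDensityOn (t 0) (t k) P g (Icc (t₀ - δ) (t₀ + δ) ×ˢ Icc (t₀ - δ) (t₀ + δ)))
    {m : ℝ} (hm0 : 0 ≤ m)
    (hm : ∀ s₁ ∈ Icc (t₀ - δ) (t₀ + δ), ∀ s₂ ∈ Icc (t₀ - δ) (t₀ + δ),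
      |g (s₁, s₂) - f s₁ * f s₂| ≤ m) {d : ℝ} (hd0 : 0 ≤ d) (hd : d ≤ δ) :
    P.real (t 0 ⁻¹' Ioc t₀ (t₀ + d)) ^ 2 - m * d ^ 2 ≤
      P.real (t 0 ⁻¹' Ioc t₀ (t₀ + d) ∩ t k ⁻¹' Ioc t₀ (t₀ + d)) := by
  obtain ⟨hgm, hg0, hlaw⟩ := hg
  set A := Ioc t₀ (t₀ + d) with hA
  set S := Icc (t₀ - δ) (t₀ + δ) with hS
  have hAm : MeasurableSet A := measurableSet_Ioc
  have hAS : A ⊆ S := fun z hz => ⟨by linarith [hz.1], by linarith [hz.2]⟩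
  have hfm : AEMeasurable (fun z => ENNReal.ofReal (f z)) (volume.restrict A) :=
    (aemeasurable_restrict_of_antitoneOn hAm (hf.2.2.1.mono fun z hz =>
      mem_Ioi.2 (ht₀.trans hz.1))).ennreal_ofReal
  have hjoint : P (t 0 ⁻¹' A ∩ t k ⁻¹' A) = ∫⁻ z in A ×ˢ A, ENNReal.ofReal (g z) := by
    have h1 := congrArg (fun μ => μ (A ×ˢ A)) hlaw
    beta_reduce at h1
    rw [Measure.restrict_apply (hAm.prod hAm), Measure.restrict_apply (hAm.prod hAm),
      inter_eq_left.2 (prod_mono hAS hAS), withDensity_apply _ (hAm.prod hAm),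
      Measure.map_apply ((ht 0).prodMk (ht k)) (hAm.prod hAm)] at h1
    exact h1
  have hvol : (volume : Measure (ℝ × ℝ)) (A ×ˢ A) = ENNReal.ofReal (d ^ 2) := by
    rw [Measure.volume_eq_prod, Measure.prod_prod, hA, Real.volume_Ioc, add_sub_cancel_left,
      ← ENNReal.ofReal_mul hd0, sq]
  have hle : P (t 0 ⁻¹' A) * P (t 0 ⁻¹' A) ≤
      P (t 0 ⁻¹' A ∩ t k ⁻¹' A) + ENNReal.ofReal (m * d ^ 2) := by
    rw [hf.measure_preimage ht hAm, ← lintegral_prod_mul hfm hfm, Measure.prod_restrict,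
      ← Measure.volume_eq_prod, hjoint]
    calc ∫⁻ z in A ×ˢ A, ENNReal.ofReal (f z.1) * ENNReal.ofReal (f z.2)
        ≤ ∫⁻ z in A ×ˢ A, (ENNReal.ofReal (g z) + ENNReal.ofReal m) := by
          refine setLIntegral_mono' (hAm.prod hAm) fun z hz => ?_
          have hz1 := hAS hz.1
          have hz2 := hAS hz.2
          rw [← ENNReal.ofReal_mul (hf.1 _), ← ENNReal.ofReal_add (hg0 z ⟨hz1, hz2⟩) hm0]
          refine ENNReal.ofReal_le_ofReal ?_
          have := (abs_le.1 (hm z.1 hz1 z.2 hz2)).1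
          simp only [Prod.mk.eta] at this
          linarith
      _ = _ := by
          rw [lintegral_add_right _ measurable_const, setLIntegral_const, hvol,
            ← ENNReal.ofReal_mul hm0]
  have h2 := ENNReal.toReal_mono (by finiteness) hle
  rw [ENNReal.toReal_mul, ENNReal.toReal_add (by finiteness) (by finiteness),
    ENNReal.toReal_ofReal (by positivity)] at h2
  simp only [measureReal_def]
  linarith

/-- The pair probabilities in small windows to the right of `t₀`, under either of the dependence
conditions. -/
theorem exists_pair_bound [IsProbabilityMeasure P] (hs : IsStationary t P)
    (hf : HasDecreasingMarginalDensity t P f) (ht : ∀ i, Measurable (t i)) {t₀ : ℝ}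
    (ht₀ : 0 < t₀) (hdep : iIndepFun t P ∨ IsWeaklyDependent t P f t₀) :
    ∃ r : ℕ → ℝ, Summable r ∧ (∀ k, 0 ≤ r k) ∧ ∃ δ : ℝ, 0 < δ ∧ ∀ d, 0 ≤ d → d ≤ δ →
      ∀ i k, 1 ≤ k → P.real (t 0 ⁻¹' Ioc t₀ (t₀ + d)) ^ 2 - r k * d ^ 2 ≤
        P.real (t i ⁻¹' Ioc t₀ (t₀ + d) ∩ t (i + k) ⁻¹' Ioc t₀ (t₀ + d)) := by
  rcases hdep with hind | ⟨-, -, δ, hδ, g, hg, hsum⟩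
  · refine ⟨fun _ => 0, summable_zero, fun _ => le_rfl, 1, one_pos, fun d _ _ i k hk => ?_⟩
    have h := (hind.indepFun (show i ≠ i + k by omega)).measure_inter_preimage_eq_mul _ _
      (measurableSet_Ioc (a := t₀) (b := t₀ + d)) (measurableSet_Ioc (a := t₀) (b := t₀ + d))
    rw [measureReal_def (μ := P) (s := t i ⁻¹' _ ∩ _), h, ENNReal.toReal_mul,
      ← measureReal_def, ← measureReal_def, hf.measureReal_preimage_eq ht measurableSet_Ioc i 0,
      hf.measureReal_preimage_eq ht measurableSet_Ioc (i + k) 0]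
    linarith
  · set r : ℕ → ENNReal := fun k => ⨆ s₁ ∈ Icc (t₀ - δ) (t₀ + δ), ⨆ s₂ ∈ Icc (t₀ - δ) (t₀ + δ),
      ENNReal.ofReal |g (k + 1) (s₁, s₂) - f s₁ * f s₂| with hr
    have hfin : ∀ k, r k ≠ ⊤ := ENNReal.ne_top_of_tsum_ne_top hsum.ne
    refine ⟨fun k => (r (k - 1)).toReal, ?_, fun _ => ENNReal.toReal_nonneg, δ, hδ,
      fun d hd0 hd i k hk => ?_⟩
    · rw [← summable_nat_add_iff 1]
      exact ENNReal.summable_toReal hsum.ne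
    · rw [measureReal_def (μ := P) (s := t i ⁻¹' _ ∩ _), hs.measure_pair ht measurableSet_Ioc,
        ← measureReal_def]
      refine (hg k hk).sq_sub_le hf ht ht₀ ENNReal.toReal_nonneg (fun s₁ h₁ s₂ h₂ => ?_) hd0 hd
      refine (ENNReal.ofReal_le_iff_le_toReal (hfin _)).1 ?_
      have h := le_iSup₂_of_le (f := fun s₁ (_ : s₁ ∈ Icc (t₀ - δ) (t₀ + δ)) =>
        ⨆ s₂ ∈ Icc (t₀ - δ) (t₀ + δ), ENNReal.ofReal |g (k - 1 + 1) (s₁, s₂) - f s₁ * f s₂|) s₁ h₁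
        (le_iSup₂_of_le s₂ h₂ le_rfl)
      rw [Nat.sub_add_cancel hk] at h
      simp only [hr, Nat.sub_add_cancel hk]
      exact h

/-! ### The local empirical process in terms of counts -/

theorem measureReal_preimage_Ioc_add [IsProbabilityMeasure P] (ht : ∀ i, Measurable (t i)) (i : ℕ)
    {x y z : ℝ} (hxy : x ≤ y) (hyz : y ≤ z) :
    P.real (t i ⁻¹' Ioc x z) = P.real (t i ⁻¹' Ioc x y) + P.real (t i ⁻¹' Ioc y z) := by
  rw [← measureReal_union _ ((ht i) measurableSet_Ioc), ← preimage_union,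
    Ioc_union_Ioc_eq_Ioc hxy hyz]
  exact (Ioc_disjoint_Ioc_of_le le_rfl).preimage _

theorem nat_mul_centeredEmp_sub [IsProbabilityMeasure P]
    (hf : HasDecreasingMarginalDensity t P f) (ht : ∀ i, Measurable (t i)) {n : ℕ} (hn : 1 ≤ n)
    {x y : ℝ} (hxy : x ≤ y) (ω : Ω) :
    (n : ℝ) * (centeredEmp t P n y ω - centeredEmp t P n x ω) =
      centeredCount t P (Ioc x y) n ω := by
  have hn' : (n : ℝ) ≠ 0 := by positivity
  unfold centeredEmp centeredCount
  rw [← mul_sub, ← Finset.sum_sub_distrib, mul_inv_cancel_left₀ hn']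
  refine Finset.sum_congr rfl fun i _ => ?_
  have h1 : margCdf t P y = margCdf t P x + P.real (t i ⁻¹' Ioc x y) := by
    rw [hf.measureReal_preimage_eq ht measurableSet_Ioc i 0]
    have e : {ω | t 0 ω ≤ y} = {ω | t 0 ω ≤ x} ∪ t 0 ⁻¹' Ioc x y := by
      change t 0 ⁻¹' Iic y = t 0 ⁻¹' Iic x ∪ t 0 ⁻¹' Ioc x y
      rw [← preimage_union, Iic_union_Ioc_eq_Iic hxy]
    unfold margCdf
    rw [e, measureReal_union _ ((ht 0) measurableSet_Ioc)]
    exact disjoint_left.2 fun ω h1 h2 => not_lt_of_ge h1 h2.1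
  have h2 : (Iic y).indicator (fun _ => (1 : ℝ)) (t i ω) =
      (Iic x).indicator (fun _ => (1 : ℝ)) (t i ω) +
        (Ioc x y).indicator (fun _ => (1 : ℝ)) (t i ω) := by
    rw [← Iic_union_Ioc_eq_Iic hxy, indicator_union_of_disjoint]
    exact disjoint_left.2 fun z h1 h2 => not_lt_of_ge h1 h2.1
  unfold centeredInd
  rw [h1, h2]
  ring

theorem localSd_eq [IsProbabilityMeasure P] (hf : HasDecreasingMarginalDensity t P f)
    (ht : ∀ i, Measurable (t i)) {t₀ : ℝ} {n : ℕ} (hn : 1 ≤ n) {d : ℝ} (hd : 0 ≤ d) :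
    localSd t P t₀ n d = √(variance (centeredCount t P (Ioc t₀ (t₀ + d)) n) P) := by
  unfold localSd
  congr 2
  ext ω
  exact nat_mul_centeredEmp_sub hf ht hn (by linarith) ω

/-- Enlarging a window increases the centered count up to the mean of the added cell. -/
theorem centeredCount_Ioc_le [IsProbabilityMeasure P] (hf : HasDecreasingMarginalDensity t P f)
    (ht : ∀ i, Measurable (t i)) {t₀ : ℝ} (ht₀ : 0 < t₀) {x y : ℝ} (hx : t₀ ≤ x) (hxy : x ≤ y)
    (n : ℕ) (ω : Ω) :
    centeredCount t P (Ioc t₀ x) n ω ≤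
      centeredCount t P (Ioc t₀ y) n ω + n * (f t₀ * (y - x)) := by
  have h : ∀ i ∈ Finset.range n, centeredInd t P (Ioc t₀ x) i ω ≤
      centeredInd t P (Ioc t₀ y) i ω + f t₀ * (y - x) := by
    intro i _
    have h1 : (Ioc t₀ x).indicator (fun _ => (1 : ℝ)) (t i ω) ≤
        (Ioc t₀ y).indicator (fun _ => (1 : ℝ)) (t i ω) :=
      indicator_le_indicator_of_subset (Ioc_subset_Ioc_right hxy) (fun _ => zero_le_one) _
    have h2 := measureReal_preimage_Ioc_add (P := P) ht i hx hxy
    have h3 := hf.measureReal_Ioc_le ht ht₀ hx hxy i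
    unfold centeredInd
    linarith
  refine (Finset.sum_le_sum h).trans (le_of_eq ?_)
  rw [Finset.sum_add_distrib, Finset.sum_const, Finset.card_range, nsmul_eq_mul]
  rfl

/-- Discretization: on the event that some window of relative length `s ∈ (0, 1)` has a count
exceeding its mean by `x`, so has one of `K` fixed windows, up to the mean of a cell. -/
theorem exists_centeredCount_grid_ge [IsProbabilityMeasure P]
    (hf : HasDecreasingMarginalDensity t P f) (ht : ∀ i, Measurable (t i)) {t₀ : ℝ} (ht₀ : 0 < t₀)
    {h : ℝ} (hh : 0 < h) {K : ℕ} (hK : 1 ≤ K) {s : ℝ} (hs : s ∈ Ioo (0 : ℝ) 1) (n : ℕ) (ω : Ω) :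
    ∃ j ∈ Finset.range K, centeredCount t P (Ioc t₀ (t₀ + s * h)) n ω - n * (f t₀ * (h / K)) ≤
      centeredCount t P (Ioc t₀ (t₀ + (j + 1) / K * h)) n ω := by
  have hK0 : (0 : ℝ) < K := by positivity
  refine ⟨⌊s * K⌋₊, ?_, ?_⟩
  · rw [Finset.mem_range, Nat.floor_lt (by have := hs.1; positivity)]
    nlinarith [hs.2]
  · have h1 : (⌊s * K⌋₊ : ℝ) ≤ s * K := Nat.floor_le (by have := hs.1; positivity)
    have h2 : s * K < ⌊s * K⌋₊ + 1 := Nat.lt_floor_add_one _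
    set j : ℝ := (⌊s * K⌋₊ : ℝ)
    have h3 : s ≤ (j + 1) / K := (le_div_iff₀ hK0).2 h2.le
    have h4 : (j + 1) / K - s ≤ 1 / K := by
      rw [div_sub' hK0.ne', div_le_div_iff_of_pos_right hK0]
      linarith
    have h5 := centeredCount_Ioc_le (P := P) hf ht ht₀ (x := t₀ + s * h)
      (y := t₀ + (j + 1) / K * h) (by have := mul_pos hs.1 hh; linarith) (by gcongr) n ω
    have h6 : (n : ℝ) * (f t₀ * (t₀ + (j + 1) / K * h - (t₀ + s * h))) ≤
        n * (f t₀ * (h / K)) := by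
      have := hf.1 t₀
      gcongr
      calc t₀ + (j + 1) / K * h - (t₀ + s * h) = ((j + 1) / K - s) * h := by ring
        _ ≤ 1 / K * h := by gcongr
        _ = h / K := by ring
    linarith

/-- If the density vanished at `t₀`, it would have a minimum there and hence derivative zero. -/
theorem HasDecreasingMarginalDensity.pos (hf : HasDecreasingMarginalDensity t P f) {t₀ : ℝ}
    (hd : deriv f t₀ < 0) : 0 < f t₀ := by
  refine lt_of_le_of_ne (hf.1 t₀) fun h0 => hd.ne ?_
  refine IsLocalMin.deriv_eq_zero (Eventually.of_forall fun x => ?_)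
  rw [← h0]
  exact hf.1 x

/-- The variance of the count in a window of length `h` is at least of the order of its mean. -/
theorem exists_le_variance_centeredCount [IsProbabilityMeasure P] (hs : IsStationary t P)
    (hf : HasDecreasingMarginalDensity t P f) (ht : ∀ i, Measurable (t i)) {t₀ : ℝ}
    (ht₀ : 0 < t₀) (hdep : iIndepFun t P ∨ IsWeaklyDependent t P f t₀) (hd : deriv f t₀ < 0) :
    ∃ η : ℝ, 0 < η ∧ ∀ h, 0 < h → h ≤ η → ∀ n : ℕ,
      n * (f t₀ / 4 * h) ≤ variance (centeredCount t P (Ioc t₀ (t₀ + h)) n) P := by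
  have hf0 : 0 < f t₀ := hf.pos hd
  have hcont : ContinuousAt f t₀ :=
    (differentiableAt_of_deriv_ne_zero hd.ne).continuousAt
  obtain ⟨ρ, hρ, hball⟩ := Metric.eventually_nhds_iff.1
    (hcont.eventually (lt_mem_nhds (half_lt_self hf0)))
  obtain ⟨r, hr, hr0, δ, hδ, hpair⟩ := exists_pair_bound hs hf ht ht₀ hdep
  set R := ∑' k, r k with hR
  have hR0 : 0 ≤ R := tsum_nonneg hr0
  refine ⟨min δ (min (ρ / 2) (f t₀ / (4 * (f t₀ ^ 2 + 2 * R)))), by positivity,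
    fun h hh0 hh n => ?_⟩
  have hhδ : h ≤ δ := hh.trans (min_le_left _ _)
  have hhρ : h ≤ ρ / 2 := hh.trans ((min_le_right _ _).trans (min_le_left _ _))
  have hhR : h * (4 * (f t₀ ^ 2 + 2 * R)) ≤ f t₀ :=
    (le_div_iff₀ (by positivity)).1 (hh.trans ((min_le_right _ _).trans (min_le_right _ _)))
  set p := P.real (t 0 ⁻¹' Ioc t₀ (t₀ + h)) with hp
  have hp1 : f t₀ / 2 * h ≤ p := by
    have := hf.le_measureReal_Ioc (x := t₀) (y := t₀ + h) ht (half_pos hf0).le (fun z hz => by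
      refine (hball ?_).le
      rw [Real.dist_eq, abs_lt]
      constructor <;> linarith [hz.1, hz.2]) 0
    simpa using this
  have hp2 : p ≤ f t₀ * h := by
    have := hf.measureReal_Ioc_le ht ht₀ (le_refl t₀) (y := t₀ + h) (by linarith) 0
    simpa using this
  have hp0 : 0 ≤ p := measureReal_nonneg
  have hvar := le_variance_centeredCount (P := P) ht (measurableSet_Ioc (a := t₀) (b := t₀ + h))
    (p := p) (fun i => hf.measureReal_preimage_eq ht measurableSet_Ioc i 0)
    (r := fun k => r k * h ^ 2) (hr.mul_right _) (fun k => mul_nonneg (hr0 k) (sq_nonneg h))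
    (hpair h hh0.le hhδ) n
  refine le_trans ?_ hvar
  gcongr
  rw [tsum_mul_right, ← hR]
  have h1 : p ^ 2 ≤ (f t₀ * h) ^ 2 := by gcongr
  have h2 : h * (h * (4 * (f t₀ ^ 2 + 2 * R))) ≤ h * f t₀ := by gcongr
  nlinarith

theorem exp_neg_div_le {y h : ℝ} (hy : 0 < y) (hh : 0 < h) :
    Real.exp (-(y / h)) ≤ 120 / y ^ 5 * h ^ 5 := by
  have h1 := Real.pow_div_factorial_le_exp (y / h) (div_pos hy hh).le 5
  have h2 : ((Nat.factorial 5 : ℕ) : ℝ) = 120 := by norm_num [Nat.factorial]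
  rw [h2] at h1
  rw [Real.exp_neg]
  calc (Real.exp (y / h))⁻¹ ≤ ((y / h) ^ 5 / 120)⁻¹ := by gcongr
    _ = _ := by field_simp

theorem nat_mul_bandwidth_pow {a : ℝ} {n : ℕ} (hn : 1 ≤ n) :
    (n : ℝ) * bandwidth a n ^ 3 = a ^ 3 := by
  have hn' : (0 : ℝ) < n := by positivity
  unfold bandwidth
  rw [mul_pow, ← Real.rpow_natCast ((n : ℝ) ^ _) 3, ← Real.rpow_mul hn'.le]
  norm_num
  rw [Real.rpow_neg_one]
  field_simp

end LocalEmpirical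

end

open LocalEmpirical in
theorem proposition4 {Ω : Type*} [MeasurableSpace Ω] (P : Measure Ω) [IsProbabilityMeasure P]
    (t : ℕ → Ω → ℝ) (ht : ∀ i, Measurable (t i))
    (hstat : LocalEmpirical.IsStationary t P)
    (f : ℝ → ℝ) (hf : LocalEmpirical.HasDecreasingMarginalDensity t P f)
    (t₀ : ℝ) (ht₀ : 0 < t₀)
    (I : Set ℝ) (hIopen : IsOpen I) (hIint : I.OrdConnected) (ht₀I : t₀ ∈ I)
    (hfC1 : ContDiffOn ℝ 1 f I) (hf' : sSup (deriv f '' I) < 0)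
    (hmom : ∀ i, Integrable (fun ω => (t i ω) ^ 5) P)
    (hdep : iIndepFun t P ∨ LocalEmpirical.IsWeaklyDependent t P f t₀)
    (a : ℝ) (ha : 0 < a)
    (ε : ℝ) (hε : 0 < ε) (τ : ℝ)
    (hτ : IsLUB (deriv f '' Icc (t₀ - ε) (t₀ + ε)) τ) (hτneg : τ < 0)
    (M : ℝ) (hM : 0 < M) (c : ℝ) (hc : 0 < c) :
    ∃ C' : ℝ, 0 < C' ∧ ∀ n : ℕ, 1 ≤ n →
      P.real {ω | M / 2 - τ * (ε * (LocalEmpirical.bandwidth a n)⁻¹ - c) <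
          ⨆ s : Ioo (0 : ℝ) 1,
            LocalEmpirical.localEmp t P t₀ n (LocalEmpirical.bandwidth a n) s ω} ≤
        C' * (LocalEmpirical.bandwidth a n) ^ 5 := by
  have hd : deriv f t₀ < 0 :=
    (hτ.1 (mem_image_of_mem _ ⟨by linarith, by linarith⟩)).trans_lt hτneg
  have hf0 : 0 < f t₀ := hf.pos hd
  obtain ⟨φ, hφ⟩ : ∃ φ, HasSummableMixing t P φ := by
    rcases hdep with hind | ⟨⟨φ, hφ, hsum⟩, -⟩
    · exact ⟨_, hasSummableMixing_of_iIndepFun ht hind⟩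
    · exact ⟨_, hasSummableMixing_of_isPhiMixing ht hφ hsum⟩
  set Φ := ∑' d, φ d with hΦ
  have hΦ0 : 0 < Φ := by
    refine one_pos.trans_le ?_
    rw [← hφ.zero]
    exact hφ.summable.le_tsum 0 fun d _ => hφ.nonneg d
  obtain ⟨η, hη, hvar⟩ := exists_le_variance_centeredCount hstat hf ht ht₀ hdep hd
  -- For small bandwidth `h` the threshold is at least `κ / h`, and `localSd` at least `b / h`.
  set κ : ℝ := -τ * ε / 2 with hκ
  have hκ0 : 0 < κ := by have := neg_pos.2 hτneg; positivity
  set b : ℝ := √(a ^ 3 * f t₀ / 4) with hb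
  have hb0 : 0 < b := Real.sqrt_pos.2 (by positivity)
  -- With `K` cells, the mean count of one cell is at most half of `b * κ / h ^ 2`.
  obtain ⟨K, hK⟩ := exists_nat_ge (2 * a ^ 3 * f t₀ / (b * κ))
  have hK0 : (0 : ℝ) < K := lt_of_lt_of_le (by positivity) hK
  have hK1 : 1 ≤ K := Nat.cast_pos.1 hK0
  set x : ℝ := b * κ / 2 with hx
  have hx0 : 0 < x := by positivity
  set y : ℝ := x ^ 2 / (2 * a ^ 3 * (2 * Φ) ^ 2) with hy
  have hy0 : 0 < y := by positivity
  set h₁ : ℝ := min η (ε / (2 * c)) with hh₁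
  have hh₁0 : 0 < h₁ := by positivity
  refine ⟨K * (120 / y ^ 5) + 1 / h₁ ^ 5, by positivity, fun n hn => ?_⟩
  have hn0 : (0 : ℝ) < n := by positivity
  have hh0 : 0 < bandwidth a n := by unfold bandwidth; positivity
  have hcube := nat_mul_bandwidth_pow (a := a) hn
  set h := bandwidth a n with hh
  rcases lt_or_ge h₁ h with hlarge | hsmall
  · calc _ ≤ (1 : ℝ) := measureReal_le_one
      _ ≤ 1 / h₁ ^ 5 * h ^ 5 := by
        rw [one_div_mul_eq_div, one_le_div (by positivity)]
        gcongr
      _ ≤ _ := by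
        gcongr
        linarith [show 0 ≤ K * (120 / y ^ 5) by positivity]
  have hu : κ / h ≤ M / 2 - τ * (ε * h⁻¹ - c) := by
    have h1 : h ≤ ε / (2 * c) := hsmall.trans (min_le_right _ _)
    have h2 : c ≤ ε / 2 * h⁻¹ := by
      rw [le_div_iff₀ (by positivity)] at h1
      rw [← div_eq_mul_inv, le_div_iff₀ hh0]
      linarith
    have h3 : -τ * c ≤ -τ * (ε / 2 * h⁻¹) := mul_le_mul_of_nonneg_left h2 (by linarith)
    have h4 : κ / h = -τ * (ε / 2 * h⁻¹) := by rw [hκ]; field_simp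
    rw [h4]
    nlinarith
  have hsd : b / h ≤ localSd t P t₀ n h := by
    rw [localSd_eq hf ht hn hh0.le]
    refine Real.le_sqrt_of_sq_le ?_
    refine le_trans (le_of_eq ?_) (hvar h hh0 (hsmall.trans (min_le_left _ _)) n)
    rw [div_pow, hb, Real.sq_sqrt (by positivity), ← hcube]
    field_simp
  have hsd0 : 0 < localSd t P t₀ n h := lt_of_lt_of_le (by positivity) hsd
  have hcell : n * (f t₀ * (h / K)) ≤ x / h ^ 2 := by
    have e : n * (f t₀ * (h / K)) = a ^ 3 * f t₀ / K / h ^ 2 := by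
      rw [← hcube]; field_simp
    rw [e, hx]
    rw [div_le_iff₀ (by positivity)] at hK
    refine div_le_div_of_nonneg_right ?_ (by positivity)
    rw [div_le_iff₀ hK0]
    linarith
  have hsub : {ω | M / 2 - τ * (ε * h⁻¹ - c) < ⨆ s : Ioo (0 : ℝ) 1, localEmp t P t₀ n h s ω} ⊆
      ⋃ j ∈ Finset.range K,
        {ω | x / h ^ 2 ≤ centeredCount t P (Ioc t₀ (t₀ + ((j : ℕ) + 1) / K * h)) n ω} := by
    intro ω hω
    have : Nonempty (Ioo (0 : ℝ) 1) := ⟨⟨1 / 2, by norm_num, by norm_num⟩⟩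
    obtain ⟨s, hs⟩ := exists_lt_of_lt_ciSup (mem_ofPred_eq ▸ hω)
    have hs0 : 0 ≤ (s : ℝ) * h := mul_nonneg s.2.1.le hh0.le
    unfold localEmp at hs
    rw [nat_mul_centeredEmp_sub hf ht hn (by linarith), inv_mul_eq_div, lt_div_iff₀ hsd0] at hs
    have h1 : 2 * (x / h ^ 2) ≤ (M / 2 - τ * (ε * h⁻¹ - c)) * localSd t P t₀ n h := by
      calc 2 * (x / h ^ 2) = κ / h * (b / h) := by rw [hx]; field_simp
        _ ≤ _ := by
          refine mul_le_mul hu hsd (by positivity) ?_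
          exact le_trans (by positivity) hu
    obtain ⟨j, hj, hjle⟩ := exists_centeredCount_grid_ge (P := P) hf ht ht₀ hh0 hK1 s.2 n ω
    refine mem_biUnion hj ?_
    change x / h ^ 2 ≤ _
    linarith
  calc _ ≤ _ := measureReal_mono hsub (measure_ne_top _ _)
    _ ≤ _ := measureReal_biUnion_finset_le _ _
    _ ≤ ∑ j ∈ Finset.range K, 120 / y ^ 5 * h ^ 5 := by
        refine Finset.sum_le_sum fun j _ => ?_
        refine (measureReal_centeredCount_ge_le hφ ht measurableSet_Ioc hn
          (by positivity)).trans ?_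
        refine le_trans (le_of_eq ?_) (exp_neg_div_le hy0 hh0)
        rw [hy, ← hΦ, ← hcube]
        congr 2
        field_simp
    _ = K * (120 / y ^ 5) * h ^ 5 := by
        rw [Finset.sum_const, Finset.card_range, nsmul_eq_mul]; ring
    _ ≤ _ := by
        gcongr
        linarith [show 0 ≤ 1 / h₁ ^ 5 by positivity]
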